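/- Let $n \ge 12$ be an even integer. Let $H_n$ be the graph on the vertices $v_1, \dots, v_n$ that is obtained from the cycle $v_1 v_2 \cdots v_n v_1$ by adding the edges $v_n v_{n/2-1}$, $v_1 v_{n-2}$, $v_{n-1} v_{n-3}$, and $v_k v_{n-2-k}$ for $2 \le k \le n/2-2$. Let $M_n$ be the following set of chords, where indices are read modulo $n$ in $\{1, \dots, n\}$: - if $n \equiv 0 \pmod 4$, the edge $v_{n/4} v_{3n/4}$ and the edges $v_{n/4+i}\, v_{n/4-i}$ for $1 \le i \le n/2-1$; - if $n \equiv 2 \pmod 4$, the edge $v_1 v_{n/2+1}$ and the edges $v_{1+i}\, v_{1-i}$ for $1 \le i \le n/2-1$. Then $H_n$ is a $3$-regular Hamiltonian graph, $M_n$ is a perfect matching of $\{v_1, \dots, v_n\}$ that has no edge in common with $H_n$, and the graph $G_n = H_n \cup M_n$ is $4$-regular, Hamiltonian and asymmetric (its only automorphism is the identity). In particular, for every even $n \ge 12$ there is an asymmetric quartic Hamiltonian graph on $n$ vertices. -/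

import Mathlib

namespace QuarticHamiltonian

/-- A graph is asymmetric if its only automorphism is the identity. -/
def IsAsymmetric {V : Type*} (G : SimpleGraph V) : Prop :=
  ∀ φ : G ≃g G, ∀ v : V, φ v = v

/-- The edges of the cubic graph, as pairs `(a, b)` of labels in `{1, …, n}` standing for `v_a v_b`:
the cycle `v_1 v_2 … v_n v_1`, the three edges `v_n v_{n/2-1}`, `v_1 v_{n-2}`, `v_{n-1} v_{n-3}`,
and the edges `v_k v_{n-2-k}` for `2 ≤ k ≤ n/2-2`. -/
def CubicEdge (n a b : ℕ) : Prop :=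
  b = a + 1 ∨ (a = n ∧ b = 1) ∨
  (a = n ∧ b = n / 2 - 1) ∨
  (a = 1 ∧ b = n - 2) ∨
  (a = n - 1 ∧ b = n - 3) ∨
  (2 ≤ a ∧ a ≤ n / 2 - 2 ∧ b = n - 2 - a)

/-- The added chords for `n ≡ 0 (mod 4)`: `v_{n/4} v_{3n/4}`, and `v_{n/4+i} v_{(n/4-i) mod n}` for
`1 ≤ i ≤ n/2-1`. -/
def ChordEdgeZero (n a b : ℕ) : Prop :=
  (a = n / 4 ∧ b = 3 * n / 4) ∨
  ∃ i ∈ Finset.Icc 1 (n / 2 - 1), a = n / 4 + i ∧ (b : ℤ) ≡ ((n / 4 : ℕ) : ℤ) - (i : ℤ) [ZMOD n]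

/-- The added chords for `n ≡ 2 (mod 4)`: `v_1 v_{n/2+1}`, and `v_{1+i} v_{(1-i) mod n}` for
`1 ≤ i ≤ n/2-1`. -/
def ChordEdgeTwo (n a b : ℕ) : Prop :=
  (a = 1 ∧ b = n / 2 + 1) ∨
  ∃ i ∈ Finset.Icc 1 (n / 2 - 1), a = 1 + i ∧ (b : ℤ) ≡ 1 - (i : ℤ) [ZMOD n]

/-- The added chords, according to the residue of the even number `n` modulo 4. -/
def ChordEdge (n a b : ℕ) : Prop :=
  if n % 4 = 0 then ChordEdgeZero n a b else ChordEdgeTwo n a b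

/-- The cubic graph; the element `x` of `Fin n` is the vertex `v_{x+1}`. -/
def cubicGraph (n : ℕ) : SimpleGraph (Fin n) :=
  SimpleGraph.fromRel fun x y => CubicEdge n (x.val + 1) (y.val + 1)

/-- The graph formed by the added chords alone, on the same vertices. -/
def chordGraph (n : ℕ) : SimpleGraph (Fin n) :=
  SimpleGraph.fromRel fun x y => ChordEdge n (x.val + 1) (y.val + 1)

/-- The quartic graph: the cubic graph together with the added chords. -/
def quarticGraph (n : ℕ) : SimpleGraph (Fin n) :=
  cubicGraph n ⊔ chordGraph n

instance (n a b : ℕ) : Decidable (CubicEdge n a b) := by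
  unfold CubicEdge; infer_instance

instance (n a b : ℕ) : Decidable (ChordEdgeZero n a b) := by
  unfold ChordEdgeZero; infer_instance

instance (n a b : ℕ) : Decidable (ChordEdgeTwo n a b) := by
  unfold ChordEdgeTwo; infer_instance

instance (n a b : ℕ) : Decidable (ChordEdge n a b) := by
  unfold ChordEdge; infer_instance

instance (n : ℕ) : DecidableRel (cubicGraph n).Adj := by
  unfold cubicGraph; infer_instance

instance (n : ℕ) : DecidableRel (chordGraph n).Adj := by
  unfold chordGraph; infer_instance

instance (n : ℕ) : DecidableRel (quarticGraph n).Adj := by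
  unfold quarticGraph; infer_instance

end QuarticHamiltonian

/-! Write `n = 2h`. Besides the cycle there are two fixed-point-free matchings. The rungs follow the
reflection `a ↦ n-2-a`, altered at six labels. The chords follow a reflection of the `n`-cycle whose
two fixed labels are joined to each other. Regularity and disjointness are read off from this, and
the cycle itself gives Hamiltonicity.

Asymmetry rests on triangles. For `n = 4m+2`, the vertex `2m+1` is the only one all of whose edges
lie in triangles, so every automorphism fixes it (`adjTwo_middle_fixed`). The 5-cycle `2m+1, 2m,
4m+2, 1, 2m+2` with the triangle `4m+2, 1, 2` attached is then preserved up to reflection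
(`AdjTwo.eq_of_triangle`), and nearby vertices exclude the reflection. For `n = 4m`, the vertex
`2m-1` plays this role, apart from one rival each for `n = 12` and `n = 16`. Its neighbourhood
induces a path (`AdjZero.eq_of_path`), whose reversal is excluded in the same way. Fixedness then
spreads to every vertex: the image of a vertex is again adjacent to its fixed neighbours, and the
other candidates are already taken (`adjTwo_all_fixed`, `adjZero_all_fixed`). -/

namespace QuarticHamiltonian

/-! ### Symmetric adjacency relations on labels -/

/-- Adjacency through the non-cycle edges of the cubic graph, `n = 2 * h`. -/
def RungAdj (h a b : ℕ) : Prop :=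
  (a = 2 * h ∧ b = h - 1) ∨ (a = h - 1 ∧ b = 2 * h) ∨
  (a = 1 ∧ b = 2 * h - 2) ∨ (a = 2 * h - 2 ∧ b = 1) ∨
  (a = 2 * h - 1 ∧ b = 2 * h - 3) ∨ (a = 2 * h - 3 ∧ b = 2 * h - 1) ∨
  (2 ≤ a ∧ 2 ≤ b ∧ a + b = 2 * h - 2 ∧ a ≠ b)

/-- Adjacency in the cycle `v_1 … v_n v_1`. -/
def CycleAdj (n a b : ℕ) : Prop :=
  b = a + 1 ∨ a = b + 1 ∨ (a = n ∧ b = 1) ∨ (a = 1 ∧ b = n)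

/-- Adjacency through the chords when `n = 4 * m`. -/
def ChordAdjZero (m a b : ℕ) : Prop :=
  (a = m ∧ b = 3 * m) ∨ (a = 3 * m ∧ b = m) ∨ (a + b = 2 * m ∧ a ≠ b) ∨ (a + b = 6 * m ∧ a ≠ b)

/-- Adjacency through the chords when `n = 4 * m + 2`. -/
def ChordAdjTwo (m a b : ℕ) : Prop :=
  (a = 1 ∧ b = 2 * m + 2) ∨ (a = 2 * m + 2 ∧ b = 1) ∨
  (2 ≤ a ∧ 2 ≤ b ∧ a + b = 4 * m + 4 ∧ a ≠ b)

/-- Adjacency of labels in the quartic graph when `n = 4 * m`. -/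
def AdjZero (m a b : ℕ) : Prop :=
  (1 ≤ a ∧ a ≤ 4 * m) ∧ (1 ≤ b ∧ b ≤ 4 * m) ∧
    (CycleAdj (4 * m) a b ∨ RungAdj (2 * m) a b ∨ ChordAdjZero m a b)

/-- Adjacency of labels in the quartic graph when `n = 4 * m + 2`. -/
def AdjTwo (m a b : ℕ) : Prop :=
  (1 ≤ a ∧ a ≤ 4 * m + 2) ∧ (1 ≤ b ∧ b ≤ 4 * m + 2) ∧
    (CycleAdj (4 * m + 2) a b ∨ RungAdj (2 * m + 1) a b ∨ ChordAdjTwo m a b)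

/-! ### Adjacency in linear form, regularity, Hamiltonicity and the matching -/

section Graph

variable {n : ℕ}

lemma rungAdj_or_cycleAdj_of_cubicEdge {h a b : ℕ} (hh : 6 ≤ h)
    (H : CubicEdge (2 * h) a b) : CycleAdj (2 * h) a b ∨ RungAdj h a b := by
  have h2 : 2 * h / 2 = h := by omega
  unfold CubicEdge at H
  rw [h2] at H
  unfold CycleAdj RungAdj
  rcases H with H | H | H | H | H | H
  · exact Or.inl (Or.inl H)
  · exact Or.inl (Or.inr (Or.inr (Or.inl H)))
  all_goals right; omega

lemma CycleAdj.symm {n a b : ℕ} (H : CycleAdj n a b) : CycleAdj n b a := by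
  unfold CycleAdj at *
  omega

lemma RungAdj.symm {h a b : ℕ} (H : RungAdj h a b) : RungAdj h b a := by
  unfold RungAdj at *
  rcases H with H | H | H | H | H | H | H
  · exact Or.inr (Or.inl H.symm)
  · exact Or.inl H.symm
  · exact Or.inr (Or.inr (Or.inr (Or.inl H.symm)))
  · exact Or.inr (Or.inr (Or.inl H.symm))
  all_goals omega

lemma cubicEdge_of_rungAdj {h a b : ℕ} (hh : 6 ≤ h) (hab : a ≤ b) (H : RungAdj h a b) :
    CubicEdge (2 * h) a b ∨ CubicEdge (2 * h) b a := by
  have h2 : 2 * h / 2 = h := by omega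
  unfold CubicEdge
  rw [h2]
  rcases H with H | H | H | H | H | H | H
  · omega
  · exact Or.inr (Or.inr (Or.inr (Or.inl H.symm)))
  · exact Or.inl (Or.inr (Or.inr (Or.inr (Or.inl H))))
  · omega
  · omega
  · exact Or.inr (Or.inr (Or.inr (Or.inr (Or.inr (Or.inl H.symm)))))
  · exact Or.inl (Or.inr (Or.inr (Or.inr (Or.inr (Or.inr (by omega))))))

lemma cubicEdge_or_iff {h a b : ℕ} (hh : 6 ≤ h) :
    (a ≠ b ∧ (CubicEdge (2 * h) a b ∨ CubicEdge (2 * h) b a)) ↔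
      CycleAdj (2 * h) a b ∨ RungAdj h a b := by
  constructor
  · rintro ⟨hab, H | H⟩
    · exact rungAdj_or_cycleAdj_of_cubicEdge hh H
    · exact (rungAdj_or_cycleAdj_of_cubicEdge hh H).imp CycleAdj.symm RungAdj.symm
  · rintro (H | H)
    · refine ⟨by unfold CycleAdj at H; omega, ?_⟩
      rcases H with H | H | H | H
      · exact Or.inl (Or.inl H)
      · exact Or.inr (Or.inl H)
      · exact Or.inl (Or.inr (Or.inl H))
      · exact Or.inr (Or.inr (Or.inl H.symm))
    · refine ⟨by unfold RungAdj at H; omega, ?_⟩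
      rcases le_total a b with hle | hle
      · exact cubicEdge_of_rungAdj hh hle H
      · exact (cubicEdge_of_rungAdj hh hle H.symm).symm

lemma cubicGraph_adj {h : ℕ} (hn : n = 2 * h) (hh : 6 ≤ h) (x y : Fin n) :
    (cubicGraph n).Adj x y ↔
      CycleAdj n (x + 1) (y + 1) ∨ RungAdj h (x + 1) (y + 1) := by
  subst hn
  rw [← cubicEdge_or_iff hh, cubicGraph, SimpleGraph.fromRel_adj,
    ne_eq, ne_eq, Fin.ext_iff, Nat.add_right_cancel_iff]

lemma chordEdgeZero_iff {m a b : ℕ} (hm : 3 ≤ m) (hb : 1 ≤ b ∧ b ≤ 4 * m) :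
    ChordEdgeZero (4 * m) a b ↔ (a = m ∧ b = 3 * m) ∨
      (m < a ∧ a < 3 * m ∧ (a + b = 2 * m ∨ a + b = 6 * m)) := by
  have h1 : 4 * m / 4 = m := by omega
  have h2 : 3 * (4 * m) / 4 = 3 * m := by omega
  have h3 : 4 * m / 2 - 1 = 2 * m - 1 := by omega
  simp only [ChordEdgeZero, h1, h2, h3, Finset.mem_Icc]
  refine or_congr Iff.rfl ⟨?_, ?_⟩
  · rintro ⟨i, hi, rfl, hc⟩
    obtain ⟨k, hk⟩ := hc.dvd
    -- Here `m - i - b = 4mk`, and the ranges of `i` and `b` leave only `k = 0` (sum `2m`) and `k =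
    -- -1` (sum `6m`).
    have hk1 : k < 1 := by
      by_contra hcon
      push Not at hcon
      have : (4 * m : ℤ) * 1 ≤ 4 * m * k := by gcongr
      push_cast at hk
      omega
    have hk2 : -2 < k := by
      by_contra hcon
      push Not at hcon
      have : (4 * m : ℤ) * k ≤ 4 * m * (-2) := by gcongr
      push_cast at hk
      omega
    obtain rfl | rfl : k = 0 ∨ k = -1 := by omega
    all_goals push_cast at hk; omega
  · rintro ⟨h4, h5, h6⟩
    refine ⟨a - m, by omega, by omega, Int.modEq_iff_dvd.2 ?_⟩
    rcases h6 with h6 | h6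
    · exact ⟨0, by push_cast; omega⟩
    · exact ⟨-1, by push_cast; omega⟩

lemma chordEdgeTwo_iff {m a b : ℕ} (hm : 3 ≤ m) (hb : 1 ≤ b ∧ b ≤ 4 * m + 2) :
    ChordEdgeTwo (4 * m + 2) a b ↔ (a = 1 ∧ b = 2 * m + 2) ∨
      (2 ≤ a ∧ a < 2 * m + 2 ∧ a + b = 4 * m + 4) := by
  have h1 : (4 * m + 2) / 2 + 1 = 2 * m + 2 := by omega
  have h3 : (4 * m + 2) / 2 - 1 = 2 * m := by omega
  simp only [ChordEdgeTwo, h1, h3, Finset.mem_Icc]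
  refine or_congr Iff.rfl ⟨?_, ?_⟩
  · rintro ⟨i, hi, rfl, hc⟩
    obtain ⟨k, hk⟩ := hc.dvd
    -- Now `1 - i - b` is negative and exceeds `-2n`, so the quotient is `-1` and `a + b = n + 2`.
    have hk1 : k < 0 := by
      by_contra hcon
      push Not at hcon
      have : (4 * m + 2 : ℤ) * 0 ≤ (4 * m + 2) * k := by gcongr
      push_cast at hk
      omega
    have hk2 : -2 < k := by
      by_contra hcon
      push Not at hcon
      have : (4 * m + 2 : ℤ) * k ≤ (4 * m + 2) * (-2) := by gcongr
      push_cast at hk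
      omega
    obtain rfl : k = -1 := by omega
    push_cast at hk
    omega
  · rintro ⟨h4, h5, h6⟩
    exact ⟨a - 1, by omega, by omega, Int.modEq_iff_dvd.2 ⟨-1, by push_cast; omega⟩⟩

lemma chordGraph_adj_zero {m : ℕ} (hn : n = 4 * m) (hm : 3 ≤ m) (x y : Fin n) :
    (chordGraph n).Adj x y ↔ ChordAdjZero m (x + 1) (y + 1) := by
  subst hn
  have hx := x.isLt
  have hy := y.isLt
  simp only [chordGraph, SimpleGraph.fromRel_adj, ChordEdge, Nat.mul_mod_right, if_true,
    chordEdgeZero_iff hm (show 1 ≤ x.val + 1 ∧ x.val + 1 ≤ 4 * m by omega),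
    chordEdgeZero_iff hm (show 1 ≤ y.val + 1 ∧ y.val + 1 ≤ 4 * m by omega),
    ChordAdjZero, ne_eq, Fin.ext_iff]
  constructor <;> intro H <;> omega

lemma chordGraph_adj_two {m : ℕ} (hn : n = 4 * m + 2) (hm : 3 ≤ m) (x y : Fin n) :
    (chordGraph n).Adj x y ↔ ChordAdjTwo m (x + 1) (y + 1) := by
  subst hn
  have hx := x.isLt
  have hy := y.isLt
  have h2 : (4 * m + 2) % 4 ≠ 0 := by omega
  simp only [chordGraph, SimpleGraph.fromRel_adj, ChordEdge, if_neg h2,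
    chordEdgeTwo_iff hm (show 1 ≤ x.val + 1 ∧ x.val + 1 ≤ 4 * m + 2 by omega),
    chordEdgeTwo_iff hm (show 1 ≤ y.val + 1 ∧ y.val + 1 ≤ 4 * m + 2 by omega),
    ChordAdjTwo, ne_eq, Fin.ext_iff]
  constructor <;> intro H <;> omega

lemma quarticGraph_adj_zero {m : ℕ} (hn : n = 4 * m) (hm : 3 ≤ m) (x y : Fin n) :
    (quarticGraph n).Adj x y ↔ AdjZero m (x + 1) (y + 1) := by
  subst hn
  have hx := x.isLt
  have hy := y.isLt
  rw [quarticGraph, SimpleGraph.sup_adj, chordGraph_adj_zero rfl hm,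
    cubicGraph_adj (h := 2 * m) (by omega) (by omega), AdjZero, or_assoc]
  exact ⟨fun H => ⟨by omega, by omega, H⟩, fun H => H.2.2⟩

lemma quarticGraph_adj_two {m : ℕ} (hn : n = 4 * m + 2) (hm : 3 ≤ m) (x y : Fin n) :
    (quarticGraph n).Adj x y ↔ AdjTwo m (x + 1) (y + 1) := by
  subst hn
  have hx := x.isLt
  have hy := y.isLt
  rw [quarticGraph, SimpleGraph.sup_adj, chordGraph_adj_two rfl hm,
    cubicGraph_adj (h := 2 * m + 1) (by omega) (by omega), AdjTwo, or_assoc]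
  exact ⟨fun H => ⟨by omega, by omega, H⟩, fun H => H.2.2⟩

lemma cycleGraph_isHamiltonian (hn : 3 ≤ n) : (SimpleGraph.cycleGraph n).IsHamiltonian := by
  obtain ⟨k, rfl⟩ := Nat.exists_eq_add_of_le' hn
  exact fun _ => ⟨0, SimpleGraph.cycleGraph.cycle k,
    SimpleGraph.Walk.isHamiltonianCycle_iff_isCycle_and_length_eq.2
      ⟨SimpleGraph.cycleGraph.isCycle_cycle, by simp⟩⟩

lemma cubicGraph_isHamiltonian {h : ℕ} (hn : n = 2 * h) (hh : 6 ≤ h) :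
    (cubicGraph n).IsHamiltonian := by
  refine SimpleGraph.IsHamiltonian.mono ?_ (cycleGraph_isHamiltonian (by omega))
  intro x y hxy
  rw [cubicGraph_adj hn hh]
  left
  rw [SimpleGraph.cycleGraph_adj'] at hxy
  have hx := x.isLt
  have hy := y.isLt
  unfold CycleAdj
  have key : ∀ u v : Fin n, (u - v).val = 1 → u.val = v.val + 1 ∨ (u.val = 0 ∧ v.val + 1 = n) := by
    intro u v huv
    have hu := u.isLt
    have hv := v.isLt
    rcases le_or_gt v u with hle | hlt
    · rw [Fin.coe_sub_iff_le.2 hle] at huv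
      omega
    · rw [Fin.coe_sub_iff_lt.2 hlt] at huv
      have := Fin.lt_def.1 hlt
      omega
  rcases hxy with hxy | hxy
  · have := key _ _ hxy; omega
  · have := key _ _ hxy; omega

lemma degree_eq_card_of_adj_iff (G : SimpleGraph (Fin n)) [DecidableRel G.Adj] (x : Fin n)
    (S : Finset ℕ) (hS : ∀ a ∈ S, 1 ≤ a ∧ a ≤ n) (hadj : ∀ y, G.Adj x y ↔ y.val + 1 ∈ S) :
    G.degree x = S.card := by
  rw [← SimpleGraph.card_neighborFinset_eq_degree]
  refine Finset.card_bij (fun y _ => y.val + 1) (fun y hy => ?_) (fun y _ z _ hyz => ?_) ?_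
  · exact (hadj y).1 ((G.mem_neighborFinset _ _).1 hy)
  · exact Fin.ext (by simpa using hyz)
  · intro a ha
    have h1 := hS a ha
    refine ⟨⟨a - 1, by omega⟩, ?_, ?_⟩
    · rw [G.mem_neighborFinset, hadj]
      simpa [Nat.sub_add_cancel h1.1] using ha
    · simp [Nat.sub_add_cancel h1.1]

lemma exists_rung {h a : ℕ} (hh : 6 ≤ h) (ha : 1 ≤ a ∧ a ≤ 2 * h) :
    ∃ c, (1 ≤ c ∧ c ≤ 2 * h) ∧ ¬ CycleAdj (2 * h) a c ∧ ∀ b, RungAdj h a b ↔ b = c := by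
  simp only [RungAdj, CycleAdj]
  by_cases h1 : a = 2 * h
  · exact ⟨h - 1, by omega, by omega, fun b => by omega⟩
  by_cases h2 : a = h - 1
  · exact ⟨2 * h, by omega, by omega, fun b => by omega⟩
  by_cases h3 : a = 2 * h - 1
  · exact ⟨2 * h - 3, by omega, by omega, fun b => by omega⟩
  by_cases h4 : a = 2 * h - 3
  · exact ⟨2 * h - 1, by omega, by omega, fun b => by omega⟩
  by_cases h5 : a = 1
  · exact ⟨2 * h - 2, by omega, by omega, fun b => by omega⟩
  by_cases h6 : a = 2 * h - 2
  · exact ⟨1, by omega, by omega, fun b => by omega⟩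
  exact ⟨2 * h - 2 - a, by omega, by omega, fun b => by omega⟩

lemma exists_chord_zero {m a : ℕ} (hm : 3 ≤ m) (ha : 1 ≤ a ∧ a ≤ 4 * m) :
    ∃ c, (1 ≤ c ∧ c ≤ 4 * m) ∧
      ∀ b, 1 ≤ b → b ≤ 4 * m → (ChordAdjZero m a b ↔ b = c) := by
  simp only [ChordAdjZero]
  by_cases h1 : a = m
  · exact ⟨3 * m, by omega, fun b _ _ => by omega⟩
  by_cases h2 : a = 3 * m
  · exact ⟨m, by omega, fun b _ _ => by omega⟩
  by_cases h3 : a < 2 * m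
  · exact ⟨2 * m - a, by omega, fun b _ _ => by omega⟩
  · exact ⟨6 * m - a, by omega, fun b _ _ => by omega⟩

lemma exists_chord_two {m a : ℕ} (hm : 3 ≤ m) (ha : 1 ≤ a ∧ a ≤ 4 * m + 2) :
    ∃ c, (1 ≤ c ∧ c ≤ 4 * m + 2) ∧
      ∀ b, 1 ≤ b → b ≤ 4 * m + 2 → (ChordAdjTwo m a b ↔ b = c) := by
  simp only [ChordAdjTwo]
  by_cases h1 : a = 1
  · exact ⟨2 * m + 2, by omega, fun b _ _ => by omega⟩
  by_cases h2 : a = 2 * m + 2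
  · exact ⟨1, by omega, fun b _ _ => by omega⟩
  · exact ⟨4 * m + 4 - a, by omega, fun b _ _ => by omega⟩

lemma exists_chord {h : ℕ} (hn : n = 2 * h) (hh : 6 ≤ h) (x : Fin n) :
    ∃ z : Fin n, ∀ y, (chordGraph n).Adj x y ↔ y = z := by
  have hx := x.isLt
  rcases Nat.even_or_odd' h with ⟨m, rfl | rfl⟩
  · obtain ⟨c, hc, H⟩ := exists_chord_zero (m := m) (a := x + 1) (by omega) (by omega)
    refine ⟨⟨c - 1, by omega⟩, fun y => ?_⟩
    have hy := y.isLt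
    rw [chordGraph_adj_zero (m := m) (by omega) (by omega), H _ (by omega) (by omega), Fin.ext_iff]
    simp only
    omega
  · obtain ⟨c, hc, H⟩ := exists_chord_two (m := m) (a := x + 1) (by omega) (by omega)
    refine ⟨⟨c - 1, by omega⟩, fun y => ?_⟩
    have hy := y.isLt
    rw [chordGraph_adj_two (m := m) (by omega) (by omega), H _ (by omega) (by omega), Fin.ext_iff]
    simp only
    omega

lemma chordGraph_isPerfectMatching {h : ℕ} (hn : n = 2 * h) (hh : 6 ≤ h) :
    (⊤ : (chordGraph n).Subgraph).IsPerfectMatching := by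
  rw [SimpleGraph.Subgraph.isPerfectMatching_iff]
  intro x
  obtain ⟨z, hz⟩ := exists_chord hn hh x
  exact ⟨z, by simp [hz], fun y hy => by simpa [hz] using hy⟩

lemma cubicGraph_disjoint_chordGraph {h : ℕ} (hn : n = 2 * h) (hh : 6 ≤ h) :
    Disjoint (cubicGraph n) (chordGraph n) := by
  rw [SimpleGraph.disjoint_left]
  intro x y h1
  have hx := x.isLt
  have hy := y.isLt
  rw [cubicGraph_adj hn hh] at h1
  rcases Nat.even_or_odd' h with ⟨m, rfl | rfl⟩
  · rw [chordGraph_adj_zero (m := m) (by omega) (by omega)]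
    unfold CycleAdj RungAdj at h1
    unfold ChordAdjZero
    omega
  · rw [chordGraph_adj_two (m := m) (by omega) (by omega)]
    unfold CycleAdj RungAdj at h1
    unfold ChordAdjTwo
    omega

lemma cubicGraph_isRegularOfDegree {h : ℕ} (hn : n = 2 * h) (hh : 6 ≤ h) :
    (cubicGraph n).IsRegularOfDegree 3 := by
  intro x
  have hx := x.isLt
  obtain ⟨c, hc, hcyc, H⟩ := exists_rung (a := x + 1) hh (by omega)
  unfold CycleAdj at hcyc
  have key : ∃ p q : ℕ, (1 ≤ p ∧ p ≤ n) ∧ (1 ≤ q ∧ q ≤ n) ∧ p ≠ q ∧ p ≠ c ∧ q ≠ c ∧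
      ∀ y, 1 ≤ y → y ≤ n → (CycleAdj n (x + 1) y ↔ y = p ∨ y = q) := by
    unfold CycleAdj
    by_cases h1 : x.val = 0
    · exact ⟨2, n, by omega, by omega, by omega, by omega, by omega, fun y _ _ => by omega⟩
    by_cases h2 : x.val + 1 = n
    · exact ⟨1, x, by omega, by omega, by omega, by omega, by omega, fun y _ _ => by omega⟩
    exact ⟨x + 2, x, by omega, by omega, by omega, by omega, by omega, fun y _ _ => by omega⟩
  obtain ⟨p, q, hp, hq, hpq, hpc, hqc, K⟩ := key
  rw [degree_eq_card_of_adj_iff _ x {p, q, c}]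
  · exact Finset.card_eq_three.2 ⟨p, q, c, hpq, hpc, hqc, rfl⟩
  · simp only [Finset.mem_insert, Finset.mem_singleton]
    rintro a (rfl | rfl | rfl) <;> omega
  · intro y
    have hy := y.isLt
    rw [cubicGraph_adj hn hh, K _ (by omega) (by omega), H]
    simp [or_assoc]

lemma quarticGraph_isRegularOfDegree {h : ℕ} (hn : n = 2 * h) (hh : 6 ≤ h) :
    (quarticGraph n).IsRegularOfDegree 4 := by
  intro x
  obtain ⟨z, hz⟩ := exists_chord hn hh x
  have hd : Disjoint ((cubicGraph n).neighborFinset x) {z} := by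
    rw [Finset.disjoint_singleton_right, SimpleGraph.mem_neighborFinset]
    exact fun h1 => SimpleGraph.disjoint_left.1 (cubicGraph_disjoint_chordGraph hn hh) _ _ h1
      ((hz z).2 rfl)
  have : (quarticGraph n).neighborFinset x = (cubicGraph n).neighborFinset x ∪ {z} := by
    ext y
    rw [SimpleGraph.mem_neighborFinset, quarticGraph, SimpleGraph.sup_adj, hz, Finset.mem_union,
      SimpleGraph.mem_neighborFinset, Finset.mem_singleton]
  rw [← SimpleGraph.card_neighborFinset_eq_degree, this, Finset.card_union_of_disjoint hd,
    SimpleGraph.card_neighborFinset_eq_degree, cubicGraph_isRegularOfDegree hn hh x,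
    Finset.card_singleton]

end Graph

/-! ### Automorphisms as permutations of labels, and propagation of fixed points -/

section Relation

variable {Q : ℕ → ℕ → Prop} {f : Equiv.Perm ℕ}

/-- The image `f d` is again a common neighbour of `x` and `y`. Were it different from `d`, it would
be fixed, and injectivity would give `f d = d`. -/
lemma fixed_of_common_neighbor (hf : ∀ a b, Q a b → Q (f a) (f b)) {x y d : ℕ}
    (hxd : Q x d) (hyd : Q y d) (hx : f x = x) (hy : f y = y)
    (h : ∀ z, Q x z → Q y z → z ≠ d → f z = z) : f d = d := by
  by_contra hne
  have h1 := hf _ _ hxd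
  have h2 := hf _ _ hyd
  rw [hx] at h1
  rw [hy] at h2
  exact hne (f.injective (h _ h1 h2 hne))

lemma fixed_of_neighbor (hf : ∀ a b, Q a b → Q (f a) (f b)) {x d : ℕ}
    (hxd : Q x d) (hx : f x = x) (h : ∀ z, Q x z → z ≠ d → f z = z) : f d = d :=
  fixed_of_common_neighbor hf hxd hxd hx hx fun z hz _ => h z hz

/-- The automorphism is extended by the identity outside `{1, …, n}`. Since `Q` never holds there,
the extension still preserves `Q`, and the arguments below can use plain natural-number labels. -/
lemma exists_perm_of_iso {n : ℕ} {G : SimpleGraph (Fin n)}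
    (hG : ∀ x y, G.Adj x y ↔ Q (x.val + 1) (y.val + 1))
    (hQ : ∀ a b, Q a b → (1 ≤ a ∧ a ≤ n) ∧ 1 ≤ b ∧ b ≤ n) (φ : G ≃g G) :
    ∃ f : Equiv.Perm ℕ, (∀ a b, Q (f a) (f b) ↔ Q a b) ∧
      ∀ x : Fin n, f (x.val + 1) = (φ x).val + 1 := by
  let e : Fin n ≃ {a : ℕ // 1 ≤ a ∧ a ≤ n} :=
    { toFun := fun x => ⟨x.val + 1, by omega⟩
      invFun := fun a => ⟨a.1 - 1, by have := a.2; omega⟩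
      left_inv := fun x => by simp
      right_inv := fun a => by have := a.2; ext; simp only; omega }
  have he : ∀ x : Fin n, (Equiv.Perm.extendDomain φ.toEquiv e) (x.val + 1) = (φ x).val + 1 := fun x =>
    Equiv.Perm.extendDomain_apply_image φ.toEquiv e x
  have hout : ∀ a : ℕ, ¬ (1 ≤ a ∧ a ≤ n) → (Equiv.Perm.extendDomain φ.toEquiv e) a = a := fun a ha =>
    Equiv.Perm.extendDomain_apply_not_subtype φ.toEquiv e ha
  have hin : ∀ a : ℕ, 1 ≤ a ∧ a ≤ n → ∃ x : Fin n, a = x.val + 1 := fun a ha =>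
    ⟨⟨a - 1, by omega⟩, by simp only; omega⟩
  refine ⟨Equiv.Perm.extendDomain φ.toEquiv e, fun a b => ?_, he⟩
  have key : ∀ x y : Fin n, Q (Equiv.Perm.extendDomain φ.toEquiv e (x.val + 1))
      (Equiv.Perm.extendDomain φ.toEquiv e (y.val + 1)) ↔ Q (x.val + 1) (y.val + 1) := fun x y => by
    rw [he, he, ← hG, ← hG, φ.map_adj_iff]
  constructor
  · intro H
    obtain ⟨h1, h2⟩ := hQ _ _ H
    have ha : 1 ≤ a ∧ a ≤ n := by
      by_contra hc
      exact hc (by rwa [hout a hc] at h1)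
    have hb : 1 ≤ b ∧ b ≤ n := by
      by_contra hc
      exact hc (by rwa [hout b hc] at h2)
    obtain ⟨x, rfl⟩ := hin a ha
    obtain ⟨y, rfl⟩ := hin b hb
    exact (key x y).1 H
  · intro H
    obtain ⟨h1, h2⟩ := hQ _ _ H
    obtain ⟨x, rfl⟩ := hin a h1
    obtain ⟨y, rfl⟩ := hin b h2
    exact (key x y).2 H

lemma isAsymmetric_of_forall_perm {n : ℕ} {G : SimpleGraph (Fin n)}
    (hG : ∀ x y, G.Adj x y ↔ Q (x.val + 1) (y.val + 1))
    (hQ : ∀ a b, Q a b → (1 ≤ a ∧ a ≤ n) ∧ 1 ≤ b ∧ b ≤ n)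
    (h : ∀ f : Equiv.Perm ℕ, (∀ a b, Q (f a) (f b) ↔ Q a b) → ∀ a, 1 ≤ a → a ≤ n → f a = a) :
    IsAsymmetric G := by
  intro φ x
  obtain ⟨f, hf, hfφ⟩ := exists_perm_of_iso hG hQ φ
  have h1 := h f hf (x.val + 1) (by omega) (by omega)
  rw [hfφ] at h1
  exact Fin.ext (by omega)

end Relation

/-! ### Asymmetry for `n = 4m + 2` -/

section Two

variable {m : ℕ} {f : Equiv.Perm ℕ}

lemma AdjTwo.symm {a b : ℕ} (H : AdjTwo m a b) : AdjTwo m b a := by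
  obtain ⟨ha, hb, H | H | H⟩ := H
  · exact ⟨hb, ha, Or.inl H.symm⟩
  · exact ⟨hb, ha, Or.inr (Or.inl H.symm)⟩
  · refine ⟨hb, ha, Or.inr (Or.inr ?_)⟩
    unfold ChordAdjTwo at *
    omega

lemma AdjTwo.iff_of {a b p q r c : ℕ} (ha : 1 ≤ a ∧ a ≤ 4 * m + 2)
    (hp : 1 ≤ p ∧ p ≤ 4 * m + 2) (hq : 1 ≤ q ∧ q ≤ 4 * m + 2)
    (hr : 1 ≤ r ∧ r ≤ 4 * m + 2) (hc : 1 ≤ c ∧ c ≤ 4 * m + 2)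
    (h1 : 1 ≤ b → b ≤ 4 * m + 2 → (CycleAdj (4 * m + 2) a b ↔ b = p ∨ b = q))
    (h2 : 1 ≤ b → b ≤ 4 * m + 2 → (RungAdj (2 * m + 1) a b ↔ b = r))
    (h3 : 1 ≤ b → b ≤ 4 * m + 2 → (ChordAdjTwo m a b ↔ b = c)) :
    AdjTwo m a b ↔ b = p ∨ b = q ∨ b = r ∨ b = c := by
  constructor
  · rintro ⟨-, ⟨hb1, hb2⟩, H⟩
    rwa [h1 hb1 hb2, h2 hb1 hb2, h3 hb1 hb2, or_assoc] at H
  · intro H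
    have hb : 1 ≤ b ∧ b ≤ 4 * m + 2 := by omega
    refine ⟨ha, hb, ?_⟩
    rwa [h1 hb.1 hb.2, h2 hb.1 hb.2, h3 hb.1 hb.2, or_assoc]

/-- These labels avoid the exceptional rungs and chords, so both matchings act by their reflections,
`a ↦ n-2-a` and `a ↦ n+2-a`. The tables that follow treat the remaining labels. -/
lemma AdjTwo.of_generic {a b : ℕ}
    (h : (2 ≤ a ∧ a ≤ 2 * m - 1) ∨ (2 * m + 3 ≤ a ∧ a ≤ 4 * m - 2)) :
    AdjTwo m a b ↔ b = a - 1 ∨ b = a + 1 ∨ b = 4 * m - a ∨ b = 4 * m + 4 - a := by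
  apply AdjTwo.iff_of <;> intros <;> (try unfold CycleAdj) <;> (try unfold RungAdj) <;>
    (try unfold ChordAdjTwo) <;> omega

lemma AdjTwo.of_one {b : ℕ} (hm : 3 ≤ m) :
    AdjTwo m 1 b ↔ b = 2 ∨ b = 4 * m + 2 ∨ b = 4 * m ∨ b = 2 * m + 2 := by
  apply AdjTwo.iff_of <;> intros <;> (try unfold CycleAdj) <;> (try unfold RungAdj) <;>
    (try unfold ChordAdjTwo) <;> omega

lemma AdjTwo.of_last {b : ℕ} (hm : 3 ≤ m) :
    AdjTwo m (4 * m + 2) b ↔ b = 4 * m + 1 ∨ b = 1 ∨ b = 2 * m ∨ b = 2 := by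
  apply AdjTwo.iff_of <;> intros <;> (try unfold CycleAdj) <;> (try unfold RungAdj) <;>
    (try unfold ChordAdjTwo) <;> omega

lemma AdjTwo.of_last_sub_one {b : ℕ} (hm : 3 ≤ m) :
    AdjTwo m (4 * m + 1) b ↔ b = 4 * m ∨ b = 4 * m + 2 ∨ b = 4 * m - 1 ∨ b = 3 := by
  apply AdjTwo.iff_of <;> intros <;> (try unfold CycleAdj) <;> (try unfold RungAdj) <;>
    (try unfold ChordAdjTwo) <;> omega

lemma AdjTwo.of_last_sub_two {b : ℕ} (hm : 3 ≤ m) :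
    AdjTwo m (4 * m) b ↔ b = 4 * m - 1 ∨ b = 4 * m + 1 ∨ b = 1 ∨ b = 4 := by
  apply AdjTwo.iff_of <;> intros <;> (try unfold CycleAdj) <;> (try unfold RungAdj) <;>
    (try unfold ChordAdjTwo) <;> omega

lemma AdjTwo.of_last_sub_three {b : ℕ} (hm : 3 ≤ m) :
    AdjTwo m (4 * m - 1) b ↔ b = 4 * m - 2 ∨ b = 4 * m ∨ b = 4 * m + 1 ∨ b = 5 := by
  apply AdjTwo.iff_of <;> intros <;> (try unfold CycleAdj) <;> (try unfold RungAdj) <;>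
    (try unfold ChordAdjTwo) <;> omega

lemma AdjTwo.of_half_sub_one {b : ℕ} (hm : 3 ≤ m) :
    AdjTwo m (2 * m) b ↔ b = 2 * m - 1 ∨ b = 2 * m + 1 ∨ b = 4 * m + 2 ∨ b = 2 * m + 4 := by
  apply AdjTwo.iff_of <;> intros <;> (try unfold CycleAdj) <;> (try unfold RungAdj) <;>
    (try unfold ChordAdjTwo) <;> omega

lemma AdjTwo.of_half {b : ℕ} (hm : 3 ≤ m) :
    AdjTwo m (2 * m + 1) b ↔ b = 2 * m ∨ b = 2 * m + 2 ∨ b = 2 * m - 1 ∨ b = 2 * m + 3 := by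
  apply AdjTwo.iff_of <;> intros <;> (try unfold CycleAdj) <;> (try unfold RungAdj) <;>
    (try unfold ChordAdjTwo) <;> omega

lemma AdjTwo.of_half_add_one {b : ℕ} (hm : 3 ≤ m) :
    AdjTwo m (2 * m + 2) b ↔ b = 2 * m + 1 ∨ b = 2 * m + 3 ∨ b = 2 * m - 2 ∨ b = 1 := by
  apply AdjTwo.iff_of <;> intros <;> (try unfold CycleAdj) <;> (try unfold RungAdj) <;>
    (try unfold ChordAdjTwo) <;> omega

/-- Each vertex other than the middle one has a neighbour with which it has no common neighbour. -/
lemma AdjTwo.exists_isolated {y : ℕ} (hm : 3 ≤ m) (h1 : 1 ≤ y) (h2 : y ≤ 4 * m + 2)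
    (hy : y ≠ 2 * m + 1) : ∃ d, AdjTwo m y d ∧ ∀ e, AdjTwo m y e → ¬ AdjTwo m d e := by
  have hcases : y = 1 ∨ y = 2 * m ∨ y = 2 * m + 2 ∨ y = 4 * m - 1 ∨ y = 4 * m ∨ y = 4 * m + 1 ∨
      y = 4 * m + 2 ∨ y = 2 * m - 1 ∨ y = 2 * m - 2 ∨
      (2 ≤ y ∧ y ≤ 2 * m - 3) ∨ (2 * m + 3 ≤ y ∧ y ≤ 4 * m - 2) := by omega
  rcases hcases with rfl | rfl | rfl | rfl | rfl | rfl | rfl | rfl | rfl | h | h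
  · refine ⟨4 * m, ?_, fun e => ?_⟩ <;> rw [of_one hm]
    · omega
    · rw [of_last_sub_two hm]; omega
  · refine ⟨4 * m + 2, ?_, fun e => ?_⟩ <;> rw [of_half_sub_one hm]
    · omega
    · rw [of_last hm]; omega
  · refine ⟨2 * m - 2, ?_, fun e => ?_⟩ <;> rw [of_half_add_one hm]
    · omega
    · rw [of_generic (by omega)]; omega
  · refine ⟨5, ?_, fun e => ?_⟩ <;> rw [of_last_sub_three hm]
    · omega
    · rw [of_generic (by omega)]; omega
  · refine ⟨1, ?_, fun e => ?_⟩ <;> rw [of_last_sub_two hm]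
    · omega
    · rw [of_one hm]; omega
  · refine ⟨3, ?_, fun e => ?_⟩ <;> rw [of_last_sub_one hm]
    · omega
    · rw [of_generic (by omega)]; omega
  · refine ⟨2 * m, ?_, fun e => ?_⟩ <;> rw [of_last hm]
    · omega
    · rw [of_half_sub_one hm]; omega
  -- The rung from `2m-1` ends at `2m+1` and lies in a triangle with `2m`, so the chord is used. For
  -- `m = 3` its end `2m+5` is the exceptional label `4m-1`.
  · refine ⟨2 * m + 5, ?_, fun e => ?_⟩ <;> rw [of_generic (by omega)]
    · omega
    · rcases hm.eq_or_lt with rfl | hm'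
      · rw [of_last_sub_three (m := 3) hm]; omega
      · rw [of_generic (by omega)]; omega
  · refine ⟨2 * m + 2, ?_, fun e => ?_⟩ <;> rw [of_generic (by omega)]
    · omega
    · rw [of_half_add_one hm]; omega
  · refine ⟨4 * m - y, ?_, fun e => ?_⟩ <;> rw [of_generic (by omega)]
    · omega
    · rw [of_generic (by omega)]; omega
  · refine ⟨4 * m - y, ?_, fun e => ?_⟩ <;> rw [of_generic (by omega)]
    · omega
    · rw [of_generic (by omega)]; omega

/-- The triangles `2m-1, 2m, 2m+1` and `2m+1, 2m+2, 2m+3` cover all four edges at `2m+1`; by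
`AdjTwo.exists_isolated` no other vertex has this property. -/
lemma adjTwo_middle_fixed (hm : 3 ≤ m) (hf : ∀ a b, AdjTwo m (f a) (f b) ↔ AdjTwo m a b) :
    f (2 * m + 1) = 2 * m + 1 := by
  by_contra hne
  have h0 : AdjTwo m (2 * m + 1) (2 * m) := (AdjTwo.of_half hm).2 (by omega)
  have hr := ((hf _ _).2 h0).1
  obtain ⟨d, hd, H⟩ := AdjTwo.exists_isolated hm hr.1 hr.2 hne
  obtain ⟨c, rfl⟩ := f.surjective d
  rw [hf] at hd
  have : ∃ e, AdjTwo m (2 * m + 1) e ∧ AdjTwo m c e := by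
    rcases (AdjTwo.of_half hm).1 hd with rfl | rfl | rfl | rfl
    · exact ⟨2 * m - 1, (AdjTwo.of_half hm).2 (by omega), (AdjTwo.of_half_sub_one hm).2 (by omega)⟩
    · exact ⟨2 * m + 3, (AdjTwo.of_half hm).2 (by omega), (AdjTwo.of_half_add_one hm).2 (by omega)⟩
    · exact ⟨2 * m, h0, (AdjTwo.of_generic (by omega)).2 (by omega)⟩
    · exact ⟨2 * m + 2, (AdjTwo.of_half hm).2 (by omega), (AdjTwo.of_generic (by omega)).2 (by omega)⟩
  obtain ⟨e, he1, he2⟩ := this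
  exact H (f e) ((hf _ _).2 he1) ((hf _ _).2 he2)

/-- The label `2` is left out because of the triangle `1, 2, 4m+2`. -/
lemma AdjTwo.not_triangle_of_generic {u w t : ℕ} (hw : w ≠ 2 * m + 1) (ht : t ≠ 2 * m + 1)
    (h : (2 < u ∧ u ≤ 2 * m - 1) ∨ (2 * m + 3 ≤ u ∧ u ≤ 4 * m - 2))
    (huw : AdjTwo m u w) (hut : AdjTwo m u t) : ¬ AdjTwo m w t := by
  rw [of_generic (by omega)] at huw hut
  rintro ⟨-, -, H⟩
  unfold CycleAdj RungAdj ChordAdjTwo at H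
  rcases huw with huw | huw | huw | huw <;> rcases H with H | H | H <;> omega

lemma AdjTwo.not_triangle_of_middle {u w t : ℕ} (hm : 3 ≤ m)
    (hw : w ≠ 2 * m + 1) (ht : t ≠ 2 * m + 1) (h : u = 2 * m ∨ u = 2 * m + 2)
    (huw : AdjTwo m u w) (hut : AdjTwo m u t) : ¬ AdjTwo m w t := by
  rintro ⟨-, -, H⟩
  unfold CycleAdj RungAdj ChordAdjTwo at H
  rcases h with rfl | rfl
  · rw [of_half_sub_one hm] at huw hut
    rcases huw with huw | huw | huw | huw <;> rcases H with H | H | H <;> omega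
  · rw [of_half_add_one hm] at huw hut
    rcases huw with huw | huw | huw | huw <;> rcases H with H | H | H <;> omega

/-- Locates the triangles avoiding `2m+1` that come within distance two of it. The third alternative
is special to `n = 14`: there the chord from `5 = 2m-1` reaches `11`, which lies in the triangle
`11, 12, 13`. -/
lemma AdjTwo.eq_of_middle_of_triangle {x u w t : ℕ} (hm : 3 ≤ m)
    (hx : AdjTwo m (2 * m + 1) x) (hxu : AdjTwo m x u)
    (huw : AdjTwo m u w) (hut : AdjTwo m u t) (hwt : AdjTwo m w t)
    (hu : u ≠ 2 * m + 1) (hw : w ≠ 2 * m + 1) (ht : t ≠ 2 * m + 1) :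
    (x = 2 * m ∧ u = 4 * m + 2) ∨ (x = 2 * m + 2 ∧ u = 1) ∨ (m = 3 ∧ u = 11 ∧ x = 5) := by
  by_contra hcon
  have h1 : ¬ ((2 < u ∧ u ≤ 2 * m - 1) ∨ (2 * m + 3 ≤ u ∧ u ≤ 4 * m - 2)) := fun h =>
    not_triangle_of_generic hw ht h huw hut hwt
  have h2 : ¬ (u = 2 * m ∨ u = 2 * m + 2) := fun h =>
    not_triangle_of_middle hm hw ht h huw hut hwt
  clear huw hut hwt
  rw [of_half hm] at hx
  rcases hx with rfl | rfl | rfl | rfl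
  · rw [of_half_sub_one hm] at hxu; omega
  · rw [of_half_add_one hm] at hxu; omega
  · rw [of_generic (by omega)] at hxu; omega
  · rw [of_generic (by omega)] at hxu; omega

/-- The previous lemma applies at both ends, to `x, u` and to `y, w`. The edge `u w` then leaves
only the two orientations; the sporadic `u = 11` has no admissible `w`. -/
lemma AdjTwo.eq_of_triangle {x u w t y : ℕ} (hm : 3 ≤ m)
    (hx : AdjTwo m (2 * m + 1) x) (hy : AdjTwo m (2 * m + 1) y) (hxu : AdjTwo m x u)
    (huw : AdjTwo m u w) (hut : AdjTwo m u t) (hwt : AdjTwo m w t) (hwy : AdjTwo m w y)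
    (hu : u ≠ 2 * m + 1) (hw : w ≠ 2 * m + 1) (ht : t ≠ 2 * m + 1) :
    (x = 2 * m ∧ u = 4 * m + 2 ∧ w = 1 ∧ t = 2 ∧ y = 2 * m + 2) ∨
      (x = 2 * m + 2 ∧ u = 1 ∧ w = 4 * m + 2 ∧ t = 2 ∧ y = 2 * m) := by
  have h1 := eq_of_middle_of_triangle hm hx hxu huw hut hwt hu hw ht
  have h2 := eq_of_middle_of_triangle hm hy hwy.symm huw.symm hwt hut hw hu ht
  rcases h1 with ⟨rfl, rfl⟩ | ⟨rfl, rfl⟩ | ⟨rfl, rfl, rfl⟩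
  · rw [of_last hm] at huw hut
    have h3 : w = 1 ∧ y = 2 * m + 2 := by omega
    obtain ⟨rfl, rfl⟩ := h3
    rw [of_one hm] at hwt
    omega
  · rw [of_one hm] at huw hut
    have h3 : w = 4 * m + 2 ∧ y = 2 * m := by omega
    obtain ⟨rfl, rfl⟩ := h3
    rw [of_last hm] at hwt
    omega
  · rw [show 11 = 4 * 3 - 1 from rfl, of_last_sub_three hm] at huw
    omega

lemma adjTwo_triangle_fixed (hm : 3 ≤ m) (hf : ∀ a b, AdjTwo m (f a) (f b) ↔ AdjTwo m a b) :
    f (4 * m + 2) = 4 * m + 2 ∧ f 1 = 1 ∧ f 2 = 2 := by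
  have hh := adjTwo_middle_fixed hm hf
  have hne : ∀ a, a ≠ 2 * m + 1 → f a ≠ 2 * m + 1 := fun a ha h =>
    ha (f.injective (h.trans hh.symm))
  have hn : ∀ a, AdjTwo m (2 * m + 1) a → AdjTwo m (2 * m + 1) (f a) := fun a ha => by
    have := (hf _ _).2 ha
    rwa [hh] at this
  have key := AdjTwo.eq_of_triangle hm
    (hn (2 * m) ((AdjTwo.of_half hm).2 (by omega)))
    (hn (2 * m + 2) ((AdjTwo.of_half hm).2 (by omega)))
    ((hf _ (4 * m + 2)).2 ((AdjTwo.of_half_sub_one hm).2 (by omega)))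
    ((hf _ 1).2 ((AdjTwo.of_last hm).2 (by omega)))
    ((hf _ 2).2 ((AdjTwo.of_last hm).2 (by omega)))
    ((hf _ _).2 ((AdjTwo.of_one hm).2 (by omega)))
    ((hf _ _).2 ((AdjTwo.of_one hm).2 (by omega)))
    (hne _ (by omega)) (hne _ (by omega)) (hne _ (by omega))
  rcases key with ⟨h1, h2, h3, h4, h5⟩ | ⟨h1, h2, h3, h4, h5⟩
  · exact ⟨h2, h3, h4⟩
  -- In the reflected case `1` and `4m+2` are swapped and `2` is fixed. This forces `4m` and `4m+1`
  -- to be swapped and `3` to go to `4`, yet `3` is adjacent to `2` and `4` is not.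
  exfalso
  have inj : ∀ a b, a ≠ b → f a ≠ f b := fun a b hab h => hab (f.injective h)
  have e1 : f (4 * m + 1) = 4 * m := by
    have h6 := (hf _ (4 * m + 1)).2 ((AdjTwo.of_last hm).2 (by omega))
    rw [h2, AdjTwo.of_one hm] at h6
    have := inj (4 * m + 1) 1 (by omega)
    have := inj (4 * m + 1) 2 (by omega)
    have := inj (4 * m + 1) (2 * m) (by omega)
    omega
  have e2 : f (4 * m) = 4 * m + 1 := by
    have h6 := (hf _ (4 * m)).2 ((AdjTwo.of_one hm).2 (by omega))
    rw [h3, AdjTwo.of_last hm] at h6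
    have := inj (4 * m) (4 * m + 2) (by omega)
    have := inj (4 * m) 2 (by omega)
    have := inj (4 * m) (2 * m + 2) (by omega)
    omega
  have e3 : f (4 * m - 1) = 4 * m - 1 := by
    have h6 := (hf _ (4 * m - 1)).2 ((AdjTwo.of_last_sub_one hm).2 (by omega))
    have h7 := (hf _ (4 * m - 1)).2 ((AdjTwo.of_last_sub_two hm).2 (by omega))
    rw [e1, AdjTwo.of_last_sub_two hm] at h6
    rw [e2, AdjTwo.of_last_sub_one hm] at h7
    omega
  have e4 : f 3 = 4 := by
    have h6 := (hf _ 3).2 ((AdjTwo.of_last_sub_one hm).2 (by omega))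
    rw [e1, AdjTwo.of_last_sub_two hm] at h6
    have := inj 3 (4 * m) (by omega)
    have := inj 3 (4 * m - 1) (by omega)
    have := inj 3 (4 * m + 2) (by omega)
    omega
  have h8 := (hf _ _).2 ((AdjTwo.of_generic (m := m) (a := 2) (b := 3) (by omega)).2 (by omega))
  rw [h4, e4, AdjTwo.of_generic (by omega)] at h8
  omega

lemma adjTwo_all_fixed (hm : 3 ≤ m) (hf : ∀ a b, AdjTwo m (f a) (f b) ↔ AdjTwo m a b)
    {a : ℕ} (h1 : 1 ≤ a) (h2 : a ≤ 4 * m + 2) : f a = a := by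
  obtain ⟨fn, f1, f2⟩ := adjTwo_triangle_fixed hm hf
  have fh := adjTwo_middle_fixed hm hf
  have hf' := fun a b => (hf a b).2
  have fh1 : f (2 * m) = 2 * m := by
    refine fixed_of_common_neighbor hf' (x := 2 * m + 1) (y := 4 * m + 2)
      ((AdjTwo.of_half hm).2 (by omega)) ((AdjTwo.of_last hm).2 (by omega)) fh fn ?_
    intro z hz hz'
    rw [AdjTwo.of_half hm] at hz
    rw [AdjTwo.of_last hm] at hz'
    omega
  have fh2 : f (2 * m + 2) = 2 * m + 2 := by
    refine fixed_of_common_neighbor hf' (x := 2 * m + 1) (y := 1)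
      ((AdjTwo.of_half hm).2 (by omega)) ((AdjTwo.of_one hm).2 (by omega)) fh f1 ?_
    intro z hz hz'
    rw [AdjTwo.of_half hm] at hz
    rw [AdjTwo.of_one hm] at hz'
    omega
  have fn1 : f (4 * m + 1) = 4 * m + 1 := by
    refine fixed_of_neighbor hf' (x := 4 * m + 2) ((AdjTwo.of_last hm).2 (by omega)) fn ?_
    intro z hz hne
    rw [AdjTwo.of_last hm] at hz
    rcases hz with rfl | rfl | rfl | rfl <;> first | assumption | exact absurd rfl hne
  have fn2 : f (4 * m) = 4 * m := by
    refine fixed_of_neighbor hf' (x := 1) ((AdjTwo.of_one hm).2 (by omega)) f1 ?_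
    intro z hz hne
    rw [AdjTwo.of_one hm] at hz
    rcases hz with rfl | rfl | rfl | rfl <;> first | assumption | exact absurd rfl hne
  have fn3 : f (4 * m - 1) = 4 * m - 1 := by
    refine fixed_of_common_neighbor hf' (x := 4 * m + 1) (y := 4 * m)
      ((AdjTwo.of_last_sub_one hm).2 (by omega)) ((AdjTwo.of_last_sub_two hm).2 (by omega))
      fn1 fn2 ?_
    intro z hz hz'
    rw [AdjTwo.of_last_sub_one hm] at hz
    rw [AdjTwo.of_last_sub_two hm] at hz'
    omega
  have f3 : f 3 = 3 := by
    refine fixed_of_neighbor hf' (x := 4 * m + 1) ((AdjTwo.of_last_sub_one hm).2 (by omega)) fn1 ?_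
    intro z hz hne
    rw [AdjTwo.of_last_sub_one hm] at hz
    rcases hz with rfl | rfl | rfl | rfl <;> first | assumption | exact absurd rfl hne
  have f4 : f 4 = 4 := by
    refine fixed_of_neighbor hf' (x := 4 * m) ((AdjTwo.of_last_sub_two hm).2 (by omega)) fn2 ?_
    intro z hz hne
    rw [AdjTwo.of_last_sub_two hm] at hz
    rcases hz with rfl | rfl | rfl | rfl <;> first | assumption | exact absurd rfl hne
  -- The fixed set grows inwards from both ends of the label range; the two blocks cover everything
  -- at `j = 2m+1`.
  have key : ∀ j, 4 ≤ j → j ≤ 2 * m + 1 → ∀ i, 1 ≤ i → i ≤ 4 * m + 2 →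
      (i ≤ j ∨ 4 * m + 3 ≤ i + j) → f i = i := by
    intro j hj
    induction j, hj using Nat.le_induction with
    | base =>
      intro _ i hi1 hi2 hi
      have : i = 1 ∨ i = 2 ∨ i = 3 ∨ i = 4 ∨ i = 4 * m - 1 ∨ i = 4 * m ∨ i = 4 * m + 1 ∨
        i = 4 * m + 2 := by omega
      rcases this with rfl | rfl | rfl | rfl | rfl | rfl | rfl | rfl <;> assumption
    | succ j hj ih =>
      intro hj2
      have ih := ih (by omega)
      -- This is the rung partner of `j - 2`, whose other neighbours are already fixed.
      have g1 : f (4 * m + 2 - j) = 4 * m + 2 - j := by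
        refine fixed_of_neighbor hf' (x := j - 2) ((AdjTwo.of_generic (by omega)).2 (by omega))
          (ih _ (by omega) (by omega) (by omega)) ?_
        intro z hz hne
        rw [AdjTwo.of_generic (by omega)] at hz
        exact ih z (by omega) (by omega) (by omega)
      -- This is the chord partner of `4m+3-j`, whose only other new neighbour was settled by `g1`.
      -- For `j = 4` that vertex is `4m-1`, whose rung is exceptional.
      have g2 : f (j + 1) = j + 1 := by
        rcases hj.eq_or_lt with rfl | hj4
        · refine fixed_of_neighbor hf' (x := 4 * m - 1)
            ((AdjTwo.of_last_sub_three hm).2 (by omega)) fn3 ?_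
          intro z hz hne
          rw [AdjTwo.of_last_sub_three hm] at hz
          by_cases hzz : z = 4 * m + 2 - 4
          · rwa [hzz]
          · exact ih z (by omega) (by omega) (by omega)
        · refine fixed_of_neighbor hf' (x := 4 * m + 3 - j)
            ((AdjTwo.of_generic (by omega)).2 (by omega))
            (ih _ (by omega) (by omega) (by omega)) ?_
          intro z hz hne
          rw [AdjTwo.of_generic (by omega)] at hz
          by_cases hzz : z = 4 * m + 2 - j
          · rwa [hzz]
          · exact ih z (by omega) (by omega) (by omega)
      intro i hi1 hi2 hi
      by_cases hi3 : i = j + 1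
      · rwa [hi3]
      by_cases hi4 : i = 4 * m + 2 - j
      · rwa [hi4]
      exact ih i hi1 hi2 (by omega)
  exact key (2 * m + 1) (by omega) le_rfl a h1 h2 (by omega)

end Two

/-! ### Asymmetry for `n = 4m` -/

section Zero

variable {m : ℕ} {f : Equiv.Perm ℕ}

lemma AdjZero.symm {a b : ℕ} (H : AdjZero m a b) : AdjZero m b a := by
  obtain ⟨ha, hb, H | H | H⟩ := H
  · exact ⟨hb, ha, Or.inl H.symm⟩
  · exact ⟨hb, ha, Or.inr (Or.inl H.symm)⟩
  · refine ⟨hb, ha, Or.inr (Or.inr ?_)⟩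
    unfold ChordAdjZero at *
    omega

lemma AdjZero.iff_of {a b p q r c : ℕ} (ha : 1 ≤ a ∧ a ≤ 4 * m)
    (hp : 1 ≤ p ∧ p ≤ 4 * m) (hq : 1 ≤ q ∧ q ≤ 4 * m)
    (hr : 1 ≤ r ∧ r ≤ 4 * m) (hc : 1 ≤ c ∧ c ≤ 4 * m)
    (h1 : 1 ≤ b → b ≤ 4 * m → (CycleAdj (4 * m) a b ↔ b = p ∨ b = q))
    (h2 : 1 ≤ b → b ≤ 4 * m → (RungAdj (2 * m) a b ↔ b = r))
    (h3 : 1 ≤ b → b ≤ 4 * m → (ChordAdjZero m a b ↔ b = c)) :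
    AdjZero m a b ↔ b = p ∨ b = q ∨ b = r ∨ b = c := by
  constructor
  · rintro ⟨-, ⟨hb1, hb2⟩, H⟩
    rwa [h1 hb1 hb2, h2 hb1 hb2, h3 hb1 hb2, or_assoc] at H
  · intro H
    have hb : 1 ≤ b ∧ b ≤ 4 * m := by omega
    refine ⟨ha, hb, ?_⟩
    rwa [h1 hb.1 hb.2, h2 hb.1 hb.2, h3 hb.1 hb.2, or_assoc]

lemma AdjZero.of_low {a b : ℕ} (h1 : 2 ≤ a) (h2 : a ≤ 2 * m - 2) (h3 : a ≠ m) :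
    AdjZero m a b ↔ b = a - 1 ∨ b = a + 1 ∨ b = 4 * m - 2 - a ∨ b = 2 * m - a := by
  apply AdjZero.iff_of <;> intros <;> (try unfold CycleAdj) <;> (try unfold RungAdj) <;>
    (try unfold ChordAdjZero) <;> omega

lemma AdjZero.of_high {a b : ℕ} (h1 : 2 * m ≤ a) (h2 : a ≤ 4 * m - 4) (h3 : a ≠ 3 * m) (hm : 3 ≤ m) :
    AdjZero m a b ↔ b = a - 1 ∨ b = a + 1 ∨ b = 4 * m - 2 - a ∨ b = 6 * m - a := by
  apply AdjZero.iff_of <;> intros <;> (try unfold CycleAdj) <;> (try unfold RungAdj) <;>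
    (try unfold ChordAdjZero) <;> omega

lemma AdjZero.of_quarter {b : ℕ} (hm : 3 ≤ m) :
    AdjZero m m b ↔ b = m - 1 ∨ b = m + 1 ∨ b = 3 * m - 2 ∨ b = 3 * m := by
  apply AdjZero.iff_of <;> intros <;> (try unfold CycleAdj) <;> (try unfold RungAdj) <;>
    (try unfold ChordAdjZero) <;> omega

/-- For `m = 3` the labels `3m` and `4m-3` coincide, so neither this table nor that of
`of_last_sub_three` is valid there. -/
lemma AdjZero.of_three_quarters {b : ℕ} (hm : 4 ≤ m) :
    AdjZero m (3 * m) b ↔ b = 3 * m - 1 ∨ b = 3 * m + 1 ∨ b = m - 2 ∨ b = m := by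
  apply AdjZero.iff_of <;> intros <;> (try unfold CycleAdj) <;> (try unfold RungAdj) <;>
    (try unfold ChordAdjZero) <;> omega

lemma AdjZero.of_one {b : ℕ} (hm : 3 ≤ m) :
    AdjZero m 1 b ↔ b = 2 ∨ b = 4 * m ∨ b = 4 * m - 2 ∨ b = 2 * m - 1 := by
  apply AdjZero.iff_of <;> intros <;> (try unfold CycleAdj) <;> (try unfold RungAdj) <;>
    (try unfold ChordAdjZero) <;> omega

lemma AdjZero.of_last {b : ℕ} (hm : 3 ≤ m) :
    AdjZero m (4 * m) b ↔ b = 4 * m - 1 ∨ b = 1 ∨ b = 2 * m - 1 ∨ b = 2 * m := by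
  apply AdjZero.iff_of <;> intros <;> (try unfold CycleAdj) <;> (try unfold RungAdj) <;>
    (try unfold ChordAdjZero) <;> omega

lemma AdjZero.of_last_sub_one {b : ℕ} (hm : 3 ≤ m) :
    AdjZero m (4 * m - 1) b ↔ b = 4 * m - 2 ∨ b = 4 * m ∨ b = 4 * m - 3 ∨ b = 2 * m + 1 := by
  apply AdjZero.iff_of <;> intros <;> (try unfold CycleAdj) <;> (try unfold RungAdj) <;>
    (try unfold ChordAdjZero) <;> omega

lemma AdjZero.of_last_sub_two {b : ℕ} (hm : 3 ≤ m) :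
    AdjZero m (4 * m - 2) b ↔ b = 4 * m - 3 ∨ b = 4 * m - 1 ∨ b = 1 ∨ b = 2 * m + 2 := by
  apply AdjZero.iff_of <;> intros <;> (try unfold CycleAdj) <;> (try unfold RungAdj) <;>
    (try unfold ChordAdjZero) <;> omega

lemma AdjZero.of_last_sub_three {b : ℕ} (hm : 4 ≤ m) :
    AdjZero m (4 * m - 3) b ↔ b = 4 * m - 4 ∨ b = 4 * m - 2 ∨ b = 4 * m - 1 ∨ b = 2 * m + 3 := by
  apply AdjZero.iff_of <;> intros <;> (try unfold CycleAdj) <;> (try unfold RungAdj) <;>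
    (try unfold ChordAdjZero) <;> omega

lemma AdjZero.of_half_sub_one {b : ℕ} (hm : 3 ≤ m) :
    AdjZero m (2 * m - 1) b ↔ b = 2 * m - 2 ∨ b = 2 * m ∨ b = 4 * m ∨ b = 1 := by
  apply AdjZero.iff_of <;> intros <;> (try unfold CycleAdj) <;> (try unfold RungAdj) <;>
    (try unfold ChordAdjZero) <;> omega

lemma AdjZero.of_half {b : ℕ} (hm : 3 ≤ m) :
    AdjZero m (2 * m) b ↔ b = 2 * m - 1 ∨ b = 2 * m + 1 ∨ b = 2 * m - 2 ∨ b = 4 * m := by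
  apply AdjZero.iff_of <;> intros <;> (try unfold CycleAdj) <;> (try unfold RungAdj) <;>
    (try unfold ChordAdjZero) <;> omega

/-- Apart from two exceptions for small `n`, each vertex other than `v_{n/2-1}` has a neighbour
with which it has no common neighbour. -/
lemma AdjZero.exists_isolated {y : ℕ} (hm : 3 ≤ m) (h1 : 1 ≤ y) (h2 : y ≤ 4 * m)
    (hy : y ≠ 2 * m - 1) (hy3 : ¬ (m = 3 ∧ y = 4)) (hy4 : ¬ (m = 4 ∧ y = 13)) :
    ∃ d, AdjZero m y d ∧ ∀ e, AdjZero m y e → ¬ AdjZero m d e := by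
  have hcases : y = 1 ∨ y = m ∨ (m = 3 ∧ y = 9) ∨ (4 ≤ m ∧ y = 3 * m) ∨ y = 2 * m - 2 ∨
      y = 2 * m ∨ (5 ≤ m ∧ y = 4 * m - 3) ∨ y = 4 * m - 2 ∨ y = 4 * m - 1 ∨ y = 4 * m ∨
      (2 ≤ y ∧ y ≤ 2 * m - 3 ∧ y ≠ m) ∨ (2 * m + 1 ≤ y ∧ y ≤ 4 * m - 4 ∧ y ≠ 3 * m) := by omega
  have key : ∀ {p q r c : ℕ} (d : ℕ),
      (∀ b, AdjZero m y b ↔ b = p ∨ b = q ∨ b = r ∨ b = c) →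
      (d = p ∨ d = q ∨ d = r ∨ d = c) → ¬ AdjZero m d p → ¬ AdjZero m d q → ¬ AdjZero m d r →
      ¬ AdjZero m d c → ∃ d, AdjZero m y d ∧ ∀ e, AdjZero m y e → ¬ AdjZero m d e := by
    intro p q r c d H hd hp hq hr hc
    refine ⟨d, (H d).2 hd, fun e he => ?_⟩
    rw [H] at he
    rcases he with rfl | rfl | rfl | rfl <;> assumption
  rcases hcases with rfl | rfl | ⟨rfl, rfl⟩ | ⟨hm', rfl⟩ | rfl | rfl | ⟨hm', rfl⟩ | rfl | rfl | rfl |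
    ⟨h3, h4, h5⟩ | ⟨h3, h4, h5⟩
  · refine key (4 * m - 2) (fun b => of_one hm) (by omega) ?_ ?_ ?_ ?_
    all_goals
      rintro ⟨-, -, H | H | H⟩
      · unfold CycleAdj at H; omega
      · unfold RungAdj at H; omega
      · unfold ChordAdjZero at H; omega
  · refine key (3 * y - 2) (fun b => of_quarter hm) (by omega) ?_ ?_ ?_ ?_
    all_goals
      rintro ⟨-, -, H | H | H⟩
      · unfold CycleAdj at H; omega
      · unfold RungAdj at H; omega
      · unfold ChordAdjZero at H; omega
  · refine key (p := 8) (q := 10) (r := 11) (c := 3) 3 (fun b => ?_) (by omega) ?_ ?_ ?_ ?_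
    · unfold AdjZero CycleAdj RungAdj ChordAdjZero
      omega
    all_goals
      rw [AdjZero.of_quarter (m := 3) hm]
      omega
  · refine key (m - 2) (fun b => of_three_quarters hm') (by omega) ?_ ?_ ?_ ?_
    all_goals
      rintro ⟨-, -, H | H | H⟩
      · unfold CycleAdj at H; omega
      · unfold RungAdj at H; omega
      · unfold ChordAdjZero at H; omega
  · refine key 2 (fun b => of_low (by omega) le_rfl (by omega)) (by omega) ?_ ?_ ?_ ?_
    all_goals
      rintro ⟨-, -, H | H | H⟩
      · unfold CycleAdj at H; omega
      · unfold RungAdj at H; omega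
      · unfold ChordAdjZero at H; omega
  · refine key (2 * m + 1) (fun b => of_half hm) (by omega) ?_ ?_ ?_ ?_
    all_goals
      rintro ⟨-, -, H | H | H⟩
      · unfold CycleAdj at H; omega
      · unfold RungAdj at H; omega
      · unfold ChordAdjZero at H; omega
  · refine key (2 * m + 3) (fun b => of_last_sub_three (by omega)) (by omega) ?_ ?_ ?_ ?_
    all_goals
      rintro ⟨-, -, H | H | H⟩
      · unfold CycleAdj at H; omega
      · unfold RungAdj at H; omega
      · unfold ChordAdjZero at H; omega
  · refine key 1 (fun b => of_last_sub_two hm) (by omega) ?_ ?_ ?_ ?_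
    all_goals
      rintro ⟨-, -, H | H | H⟩
      · unfold CycleAdj at H; omega
      · unfold RungAdj at H; omega
      · unfold ChordAdjZero at H; omega
  · refine key (2 * m + 1) (fun b => of_last_sub_one hm) (by omega) ?_ ?_ ?_ ?_
    all_goals
      rintro ⟨-, -, H | H | H⟩
      · unfold CycleAdj at H; omega
      · unfold RungAdj at H; omega
      · unfold ChordAdjZero at H; omega
  · refine key (4 * m - 1) (fun b => of_last hm) (by omega) ?_ ?_ ?_ ?_
    all_goals
      rintro ⟨-, -, H | H | H⟩
      · unfold CycleAdj at H; omega
      · unfold RungAdj at H; omega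
      · unfold ChordAdjZero at H; omega
  · refine key (4 * m - 2 - y) (fun b => of_low (by omega) (by omega) h5) (by omega) ?_ ?_ ?_ ?_
    all_goals
      rintro ⟨-, -, H | H | H⟩
      · unfold CycleAdj at H; omega
      · unfold RungAdj at H; omega
      · unfold ChordAdjZero at H; omega
  · refine key (4 * m - 2 - y) (fun b => of_high (by omega) (by omega) h5 hm) (by omega) ?_ ?_ ?_ ?_
    all_goals
      rintro ⟨-, -, H | H | H⟩
      · unfold CycleAdj at H; omega
      · unfold RungAdj at H; omega
      · unfold ChordAdjZero at H; omega

/-- The neighbourhood of `2m-1` induces exactly the path `2m-2, 2m, 4m, 1`. The inner vertices `b`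
and `c` each have two neighbours within it, hence are `2m` and `4m` in some order. -/
lemma AdjZero.eq_of_path {a b c d : ℕ} (hm : 3 ≤ m)
    (ha : AdjZero m (2 * m - 1) a) (hb : AdjZero m (2 * m - 1) b)
    (hc : AdjZero m (2 * m - 1) c) (hd : AdjZero m (2 * m - 1) d)
    (hba : AdjZero m b a) (hbc : AdjZero m b c) (hcd : AdjZero m c d) (hac : a ≠ c) (hbd : b ≠ d) :
    (a = 2 * m - 2 ∧ b = 2 * m ∧ c = 4 * m ∧ d = 1) ∨
      (a = 1 ∧ b = 4 * m ∧ c = 2 * m ∧ d = 2 * m - 2) := by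
  rw [of_half_sub_one hm] at ha hb hc hd
  have h1 : b = 2 * m ∨ b = 4 * m := by
    rcases hb with rfl | rfl | rfl | rfl
    · rw [of_low (by omega) (by omega) (by omega)] at hba hbc; omega
    · omega
    · omega
    · rw [of_one hm] at hba hbc; omega
  have h2 : c = 2 * m ∨ c = 4 * m := by
    rcases hc with rfl | rfl | rfl | rfl
    · have := hbc.symm
      rw [of_low (by omega) (by omega) (by omega)] at this hcd; omega
    · omega
    · omega
    · have := hbc.symm
      rw [of_one hm] at this hcd; omega
  rcases h1 with rfl | rfl <;> rcases h2 with rfl | rfl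
  · rw [of_half hm] at hbc; omega
  · rw [of_half hm] at hba
    rw [of_last hm] at hcd
    omega
  · rw [of_last hm] at hba
    rw [of_half hm] at hcd
    omega
  · rw [of_last hm] at hbc; omega

/-- The path in its neighbourhood puts every edge at `2m-1` in a triangle. `AdjZero.exists_isolated`
rules out all other images except two sporadic ones. -/
lemma adjZero_center_fixed (hm : 3 ≤ m) (hf : ∀ a b, AdjZero m (f a) (f b) ↔ AdjZero m a b) :
    f (2 * m - 1) = 2 * m - 1 := by
  by_contra hne
  have N : ∀ b, AdjZero m (2 * m - 1) b ↔ b = 2 * m - 2 ∨ b = 2 * m ∨ b = 4 * m ∨ b = 1 :=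
    fun b => AdjZero.of_half_sub_one hm
  have ha := (hf _ _).2 ((N (2 * m - 2)).2 (by omega))
  have hb := (hf _ _).2 ((N (2 * m)).2 (by omega))
  have hc := (hf _ _).2 ((N (4 * m)).2 (by omega))
  have hd := (hf _ _).2 ((N 1).2 (by omega))
  have hba := (hf _ (2 * m - 2)).2 ((AdjZero.of_half hm).2 (by omega))
  have hbc := (hf _ (4 * m)).2 ((AdjZero.of_half hm).2 (by omega))
  have hcd := (hf _ 1).2 ((AdjZero.of_last hm).2 (by omega))
  have hac : f (2 * m - 2) ≠ f (4 * m) := fun h => by have := f.injective h; omega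
  -- Every edge at this rival lies in a triangle too, but its neighbourhood induces two disjoint
  -- edges, so no `b` there has two distinct neighbours `a`, `c`. The same holds for `13` when `m =
  -- 4`.
  by_cases h3 : m = 3 ∧ f (2 * m - 1) = 4
  · obtain ⟨rfl, h4⟩ := h3
    rw [h4] at ha hb hc
    rw [AdjZero.of_low (m := 3) (by omega) (by omega) (by omega)] at ha hb hc
    generalize f (2 * 3) = b at *
    generalize f (2 * 3 - 2) = a at *
    generalize f (4 * 3) = c at *
    rcases hb with rfl | rfl | rfl | rfl
    · have h5 := AdjZero.of_quarter (m := 3) (b := a) hm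
      have h6 := AdjZero.of_quarter (m := 3) (b := c) hm
      have := h5.1 hba
      have := h6.1 hbc
      omega
    · have h5 := AdjZero.of_half_sub_one (m := 3) (b := a) hm
      have h6 := AdjZero.of_half_sub_one (m := 3) (b := c) hm
      have := h5.1 hba
      have := h6.1 hbc
      omega
    · have h5 := AdjZero.of_half (m := 3) (b := a) hm
      have h6 := AdjZero.of_half (m := 3) (b := c) hm
      have := h5.1 hba
      have := h6.1 hbc
      omega
    · rw [AdjZero.of_low (m := 3) (by omega) (by omega) (by omega)] at hba hbc
      omega
  by_cases h4 : m = 4 ∧ f (2 * m - 1) = 13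
  · obtain ⟨rfl, h4⟩ := h4
    rw [h4] at ha hb hc
    have N' := fun b => AdjZero.of_last_sub_three (m := 4) (b := b) le_rfl
    have ha := (N' _).1 ha
    have hb := (N' _).1 hb
    have hc := (N' _).1 hc
    generalize f (2 * 4) = b at *
    generalize f (2 * 4 - 2) = a at *
    generalize f (4 * 4) = c at *
    rcases hb with rfl | rfl | rfl | rfl
    · have h5 := (AdjZero.of_three_quarters (m := 4) (b := a) le_rfl).1 hba
      have h6 := (AdjZero.of_three_quarters (m := 4) (b := c) le_rfl).1 hbc
      omega
    · have h5 := (AdjZero.of_last_sub_two (m := 4) (b := a) hm).1 hba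
      have h6 := (AdjZero.of_last_sub_two (m := 4) (b := c) hm).1 hbc
      omega
    · have h5 := (AdjZero.of_last_sub_one (m := 4) (b := a) hm).1 hba
      have h6 := (AdjZero.of_last_sub_one (m := 4) (b := c) hm).1 hbc
      omega
    · rw [AdjZero.of_high (m := 4) (by omega) (by omega) (by omega) hm] at hba hbc
      omega
  obtain ⟨d, hd', H⟩ := AdjZero.exists_isolated hm ha.1.1 ha.1.2 hne h3 h4
  obtain ⟨e, rfl⟩ := f.surjective d
  rw [hf, N] at hd'
  rcases hd' with rfl | rfl | rfl | rfl
  · exact H _ hb hba.symm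
  · exact H _ ha hba
  · exact H _ hb hbc.symm
  · exact H _ hc hcd.symm

lemma adjZero_path_fixed (hm : 3 ≤ m) (hf : ∀ a b, AdjZero m (f a) (f b) ↔ AdjZero m a b) :
    f (2 * m - 2) = 2 * m - 2 ∧ f (2 * m) = 2 * m ∧ f (4 * m) = 4 * m ∧ f 1 = 1 := by
  have hh := adjZero_center_fixed hm hf
  have inj : ∀ a b, a ≠ b → f a ≠ f b := fun a b hab h => hab (f.injective h)
  have hn : ∀ a, AdjZero m (2 * m - 1) a → AdjZero m (2 * m - 1) (f a) := fun a ha => by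
    have := (hf _ _).2 ha
    rwa [hh] at this
  have key := AdjZero.eq_of_path hm
    (hn (2 * m - 2) ((AdjZero.of_half_sub_one hm).2 (by omega)))
    (hn (2 * m) ((AdjZero.of_half_sub_one hm).2 (by omega)))
    (hn (4 * m) ((AdjZero.of_half_sub_one hm).2 (by omega)))
    (hn 1 ((AdjZero.of_half_sub_one hm).2 (by omega)))
    ((hf _ _).2 ((AdjZero.of_half hm).2 (by omega)))
    ((hf _ _).2 ((AdjZero.of_half hm).2 (by omega)))
    ((hf _ _).2 ((AdjZero.of_last hm).2 (by omega)))
    (inj _ _ (by omega)) (inj _ _ (by omega))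
  rcases key with h | ⟨h1, h2, h3, h4⟩
  · exact h
  -- If the path is reversed, `4m-1` goes to `2m+1`. The adjacent neighbours `4m-2` and `4m-3` of
  -- `4m-1` would land among `2m+2`, `2m-3`, `4m-1`, which are pairwise non-adjacent.
  exfalso
  have e1 : f (4 * m - 1) = 2 * m + 1 := by
    have h6 := (hf _ (4 * m - 1)).2 ((AdjZero.of_last hm).2 (by omega))
    rw [h3, AdjZero.of_half hm] at h6
    have := inj (4 * m - 1) (2 * m - 1) (by omega)
    have := inj (4 * m - 1) 1 (by omega)
    have := inj (4 * m - 1) (2 * m) (by omega)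
    omega
  have hN : ∀ z, z ≠ 4 * m → AdjZero m (4 * m - 1) z →
      f z = 2 * m + 2 ∨ f z = 2 * m - 3 ∨ f z = 4 * m - 1 := by
    intro z hz hz'
    have h6 := (hf _ _).2 hz'
    rw [e1, AdjZero.of_high (by omega) (by omega) (by omega) hm] at h6
    have := inj z (4 * m) hz
    omega
  have h6 := hN (4 * m - 2) (by omega) ((AdjZero.of_last_sub_one hm).2 (by omega))
  have h7 := hN (4 * m - 3) (by omega) ((AdjZero.of_last_sub_one hm).2 (by omega))
  have h8 := (hf _ _).2 ((AdjZero.of_last_sub_two (b := 4 * m - 3) hm).2 (by omega))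
  generalize f (4 * m - 2) = u at *
  generalize f (4 * m - 3) = w at *
  obtain ⟨-, -, h8⟩ := h8
  unfold CycleAdj RungAdj ChordAdjZero at h8
  rcases h6 with rfl | rfl | rfl <;> rcases h8 with H | H | H <;> omega

lemma adjZero_all_fixed (hm : 3 ≤ m) (hf : ∀ a b, AdjZero m (f a) (f b) ↔ AdjZero m a b)
    {a : ℕ} (h1 : 1 ≤ a) (h2 : a ≤ 4 * m) : f a = a := by
  obtain ⟨fh2, fh, fn, f1⟩ := adjZero_path_fixed hm hf
  have fh1 := adjZero_center_fixed hm hf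
  have hf' := fun a b => (hf a b).2
  have fn1 : f (4 * m - 1) = 4 * m - 1 := by
    refine fixed_of_neighbor hf' (x := 4 * m) ((AdjZero.of_last hm).2 (by omega)) fn ?_
    intro z hz hne
    rw [AdjZero.of_last hm] at hz
    rcases hz with rfl | rfl | rfl | rfl <;> first | assumption | exact absurd rfl hne
  have fh3 : f (2 * m + 1) = 2 * m + 1 := by
    refine fixed_of_neighbor hf' (x := 2 * m) ((AdjZero.of_half hm).2 (by omega)) fh ?_
    intro z hz hne
    rw [AdjZero.of_half hm] at hz
    rcases hz with rfl | rfl | rfl | rfl <;> first | assumption | exact absurd rfl hne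
  have f2 : f 2 = 2 := by
    refine fixed_of_common_neighbor hf' (x := 1) (y := 2 * m - 2)
      ((AdjZero.of_one hm).2 (by omega))
      ((AdjZero.of_low (by omega) le_rfl (by omega)).2 (by omega)) f1 fh2 ?_
    intro z hz hz' hne
    rw [AdjZero.of_one hm] at hz
    rw [AdjZero.of_low (by omega) le_rfl (by omega)] at hz'
    have hzz : z = 2 * m - 1 := by omega
    rwa [hzz]
  have fn2 : f (4 * m - 2) = 4 * m - 2 := by
    refine fixed_of_neighbor hf' (x := 1) ((AdjZero.of_one hm).2 (by omega)) f1 ?_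
    intro z hz hne
    rw [AdjZero.of_one hm] at hz
    rcases hz with rfl | rfl | rfl | rfl <;> first | assumption | exact absurd rfl hne
  -- Fixed blocks grow from both ends of the range and in both directions from the middle. They meet
  -- at `j = m-1`, so the exceptional chord `m, 3m` is never used.
  have key : ∀ j, 1 ≤ j → j ≤ m - 1 → ∀ i, 1 ≤ i → i ≤ 4 * m →
      (i ≤ j ∨ (2 * m - 1 ≤ i + j ∧ i ≤ 2 * m + j) ∨ 4 * m - 1 ≤ i + j) → f i = i := by
    intro j hj
    induction j, hj using Nat.le_induction with
    | base =>
      intro _ i hi1 hi2 hi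
      have : i = 1 ∨ i = 2 * m - 2 ∨ i = 2 * m - 1 ∨ i = 2 * m ∨ i = 2 * m + 1 ∨ i = 4 * m - 2 ∨
        i = 4 * m - 1 ∨ i = 4 * m := by omega
      rcases this with rfl | rfl | rfl | rfl | rfl | rfl | rfl | rfl <;> assumption
    | succ j hj ih =>
      intro hj2
      have ih := ih (by omega)
      -- Both `j+1` and the rung partner of `j` may still be unknown, so a second fixed neighbour is
      -- needed: the chord partner `2m-1-j` of `j+1`.
      have g1 : f (j + 1) = j + 1 := by
        rcases hj.eq_or_lt with rfl | hj'
        · exact f2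
        refine fixed_of_common_neighbor hf' (x := j) (y := 2 * m - 1 - j)
          ((AdjZero.of_low (by omega) (by omega) (by omega)).2 (by omega))
          ((AdjZero.of_low (by omega) (by omega) (by omega)).2 (by omega))
          (ih _ (by omega) (by omega) (by omega)) (ih _ (by omega) (by omega) (by omega)) ?_
        intro z hz hz' hne
        rw [AdjZero.of_low (by omega) (by omega) (by omega)] at hz hz'
        exact ih z (by omega) (by omega) (by omega)
      have g2 : f (4 * m - 2 - j) = 4 * m - 2 - j := by
        rcases hj.eq_or_lt with rfl | hj'
        · refine fixed_of_neighbor hf' (x := 4 * m - 1)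
            ((AdjZero.of_last_sub_one hm).2 (by omega)) fn1 ?_
          intro z hz hne
          rw [AdjZero.of_last_sub_one hm] at hz
          exact ih z (by omega) (by omega) (by omega)
        · refine fixed_of_neighbor hf' (x := j)
            ((AdjZero.of_low (by omega) (by omega) (by omega)).2 (by omega))
            (ih _ (by omega) (by omega) (by omega)) ?_
          intro z hz hne
          rw [AdjZero.of_low (by omega) (by omega) (by omega)] at hz
          by_cases hzz : z = j + 1
          · rwa [hzz]
          · exact ih z (by omega) (by omega) (by omega)
      have g3 : f (2 * m - 2 - j) = 2 * m - 2 - j := by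
        refine fixed_of_neighbor hf' (x := 2 * m - 1 - j)
          ((AdjZero.of_low (by omega) (by omega) (by omega)).2 (by omega))
          (ih _ (by omega) (by omega) (by omega)) ?_
        intro z hz hne
        rw [AdjZero.of_low (by omega) (by omega) (by omega)] at hz
        by_cases hzz : z = j + 1
        · rwa [hzz]
        · exact ih z (by omega) (by omega) (by omega)
      have g4 : f (2 * m + j + 1) = 2 * m + j + 1 := by
        refine fixed_of_neighbor hf' (x := 2 * m + j)
          ((AdjZero.of_high (by omega) (by omega) (by omega) hm).2 (by omega))
          (ih _ (by omega) (by omega) (by omega)) ?_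
        intro z hz hne
        rw [AdjZero.of_high (by omega) (by omega) (by omega) hm] at hz
        by_cases hzz : z = 2 * m - 2 - j
        · rwa [hzz]
        · exact ih z (by omega) (by omega) (by omega)
      intro i hi1 hi2 hi
      by_cases hi3 : i = j + 1
      · rwa [hi3]
      by_cases hi4 : i = 4 * m - 2 - j
      · rwa [hi4]
      by_cases hi5 : i = 2 * m - 2 - j
      · rwa [hi5]
      by_cases hi6 : i = 2 * m + j + 1
      · rwa [hi6]
      exact ih i hi1 hi2 (by omega)
  exact key (m - 1) (by omega) le_rfl a h1 h2 (by omega)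

end Zero
-- Both residues combined, and the main theorem
lemma quarticGraph_isAsymmetric {n h : ℕ} (hn : n = 2 * h) (hh : 6 ≤ h) :
    IsAsymmetric (quarticGraph n) := by
  rcases Nat.even_or_odd' h with ⟨m, rfl | rfl⟩
  · have hm : 3 ≤ m := by omega
    obtain rfl : n = 4 * m := by omega
    exact isAsymmetric_of_forall_perm (quarticGraph_adj_zero rfl hm)
      (fun a b H => ⟨H.1, H.2.1⟩) fun f hf a => adjZero_all_fixed hm hf
  · have hm : 3 ≤ m := by omega
    obtain rfl : n = 4 * m + 2 := by omega
    exact isAsymmetric_of_forall_perm (quarticGraph_adj_two rfl hm)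
      (fun a b H => ⟨H.1, H.2.1⟩) fun f hf a => adjTwo_all_fixed hm hf

end QuarticHamiltonian

theorem mainTheorem3 (n : ℕ) (hn : 12 ≤ n) (heven : Even n) :
    (QuarticHamiltonian.cubicGraph n).IsRegularOfDegree 3 ∧
    (QuarticHamiltonian.cubicGraph n).IsHamiltonian ∧
    (⊤ : (QuarticHamiltonian.chordGraph n).Subgraph).IsPerfectMatching ∧
    Disjoint (QuarticHamiltonian.cubicGraph n) (QuarticHamiltonian.chordGraph n) ∧
    (QuarticHamiltonian.quarticGraph n).IsRegularOfDegree 4 ∧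
    (QuarticHamiltonian.quarticGraph n).IsHamiltonian ∧
    QuarticHamiltonian.IsAsymmetric (QuarticHamiltonian.quarticGraph n) := by
  obtain ⟨h, hh⟩ := heven
  have hn2 : n = 2 * h := by omega
  have h6 : 6 ≤ h := by omega
  have hH := QuarticHamiltonian.cubicGraph_isHamiltonian hn2 h6
  exact ⟨QuarticHamiltonian.cubicGraph_isRegularOfDegree hn2 h6, hH,
    QuarticHamiltonian.chordGraph_isPerfectMatching hn2 h6,
    QuarticHamiltonian.cubicGraph_disjoint_chordGraph hn2 h6,
    QuarticHamiltonian.quarticGraph_isRegularOfDegree hn2 h6, hH.mono le_sup_left,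
    QuarticHamiltonian.quarticGraph_isAsymmetric hn2 h6⟩
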